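/- Let $n\ge 2$ and $L(q)=|q|^2/2$ for $q\in\mathbb{R}^n$, and for a bounded continuous $u:\mathbb{R}^n\to\mathbb{R}$ and $t>0$ let $$u_t(x)=\inf_{y\in\mathbb{R}^n}\Big(u(y)+tL\big(\tfrac{y-x}{t}\big)\Big)$$ be the infimal convolution of $u$. There is a continuous, compactly supported function $u\in W^{1,n}(\mathbb{R}^n)$ such that every $u_t$, $t>0$, is differentiable almost everywhere and $|Du_t|\to\infty$ as $t\to0^+$ on a measurable set $E$ of positive Lebesgue measure, in the following sense. For every $x\in E$, $u_t$ is differentiable at $x$ for almost every $t>0$, and $|Du_t(x)|\to\infty$ as $t\to0^+$ through those $t$ for which $u_t$ is differentiable at $x$. Moreover, also at the exceptional $t$, the derivative is large: for every $x\in E$ and $M\in\mathbb{R}$ there is $\delta>0$ such that for every $t\in(0,\delta)$ there is a unit vector $\gamma$ for which the one-sided directional derivative $D_\gamma u_t(x)=\lim_{s\to0^+}\frac{u_t(x+s\gamma)-u_t(x)}{s}$ exists and satisfies $|D_\gamma u_t(x)|\ge M$. Consequently, for every $1\le p\le n$ the function $u$ lies in $W^{1,p}(\mathbb{R}^n)$,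 but $Du_t$ does not converge to the weak gradient $Du$ in $L^p(\mathbb{R}^n)$ as $t\to0^+$. -/

import Mathlib

open MeasureTheory Filter Topology Set
open scoped ENNReal ContDiff Gradient

noncomputable section

/-- The infimal convolution (Hopf-Lax formula)
`u_t(x) = inf_y ( u(y) + t L((y - x) / t) )`; it is used for `t > 0` only. -/
def infConv {n : ℕ} (L u : EuclideanSpace ℝ (Fin n) → ℝ) (t : ℝ)
    (x : EuclideanSpace ℝ (Fin n)) : ℝ :=
  ⨅ y : EuclideanSpace ℝ (Fin n), (u y + t * L (t⁻¹ • (y - x)))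

/-- The function `L(q) = |q|² / 2`. -/
def quadL {n : ℕ} (q : EuclideanSpace ℝ (Fin n)) : ℝ := ‖q‖ ^ 2 / 2

/-- `g` is the weak (distributional) gradient of `u` on `ℝⁿ`: both are locally integrable and
`∫ u ∂_v φ = - ∫ ⟨g, v⟩ φ` for all test functions `φ` and all directions `v`. -/
def HasWeakGradient {n : ℕ} (u : EuclideanSpace ℝ (Fin n) → ℝ)
    (g : EuclideanSpace ℝ (Fin n) → EuclideanSpace ℝ (Fin n)) : Prop :=
  LocallyIntegrable u volume ∧ LocallyIntegrable g volume ∧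
    ∀ φ : EuclideanSpace ℝ (Fin n) → ℝ, ContDiff ℝ ∞ φ → HasCompactSupport φ →
      ∀ v : EuclideanSpace ℝ (Fin n),
        ∫ x, u x * fderiv ℝ φ x v = - ∫ x, inner ℝ (g x) v * φ x

/-- Membership in the Sobolev space `W^{1,p}(ℝⁿ)`. -/
def MemW1p {n : ℕ} (u : EuclideanSpace ℝ (Fin n) → ℝ) (p : ℝ≥0∞) : Prop :=
  MemLp u p volume ∧
    ∃ g : EuclideanSpace ℝ (Fin n) → EuclideanSpace ℝ (Fin n),
      HasWeakGradient u g ∧ MemLp g p volume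

/-- `d` is the one-sided directional derivative `lim_{s → 0+} (f(x + s γ) - f(x)) / s`. -/
def HasDirDeriv {n : ℕ} (f : EuclideanSpace ℝ (Fin n) → ℝ) (d : ℝ)
    (x γ : EuclideanSpace ℝ (Fin n)) : Prop :=
  HasDerivWithinAt (fun s : ℝ => f (x + s • γ)) d (Ici 0) 0

end

/-! ### Semiconcavity of the infimal convolution and its derivatives at minimizers -/

section InfConv

variable {n : ℕ} {u : EuclideanSpace ℝ (Fin n) → ℝ} {C t : ℝ}

/-! A point has zero `n`-capacity when `n ≥ 2`: a logarithmic cut-off of height one can have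
arbitrarily small support and arbitrarily small gradient in `Lⁿ`. So `u` can carry, for every `k`,
downward spikes of depth `4⁻ᵏ` at all points of a fine grid, with gradient at most `2⁻ᵏ` in `Lⁿ`
(`exists_spike`, `exists_gridSpikes`). The series of spikes converges uniformly and its gradients
converge in `Lⁿ` (`hasWeakGradient_tsum`). The spikes are so thin that the balls of twice their
radius cover at most half the volume of the unit ball; the rest is `goodSet`.

Let `x` be in this set and let `t` lie between `timeScale n (k + 1)` and `timeScale n k`. Jumping to
a nearby `k`-th spike costs at most a quarter of its depth, so `u_t(x) ≤ -(3/4) 4⁻ᵏ`. A point `y`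
with `|y - x| ≤ 2ᵏ t` is within `spikeRadius n k` of `x`, hence off all spikes of index at most `k`,
and the later ones leave `u(y) ≥ -(1/3) 4⁻ᵏ`. Thus every minimizer satisfies `|y - x| > 2ᵏ t`
(`lt_norm_minimizer_sub`).

For a minimizer `y`, the function `u(y) + |y - ·|² / (2t)` touches `u_t` from above at `x`. Hence
`Du_t(x) = (x - y) / t` wherever it exists, and semiconcavity provides a one-sided derivative of
size at least `|y - x| / t` in any case. Convergence in `Lᵖ` would force pointwise convergence along
a sequence of times, which the blow-up on a set of positive measure excludes. -/

lemma infConv_quadL_eq (ht : 0 < t) (x : EuclideanSpace ℝ (Fin n)) :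
    infConv quadL u t x = ⨅ y, (u y + ‖y - x‖ ^ 2 / (2 * t)) := by
  unfold infConv quadL
  congr 1; ext y
  rw [norm_smul, norm_inv, Real.norm_of_nonneg ht.le]
  field_simp

lemma bddBelow_infConv (hb : ∀ y, -C ≤ u y) (ht : 0 < t) (x : EuclideanSpace ℝ (Fin n)) :
    BddBelow (range fun y => u y + ‖y - x‖ ^ 2 / (2 * t)) := by
  refine ⟨-C, ?_⟩
  rintro _ ⟨y, rfl⟩
  have := hb y
  have : 0 ≤ ‖y - x‖ ^ 2 / (2 * t) := by positivity
  simp only; linarith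

lemma infConv_quadL_le (hb : ∀ y, -C ≤ u y) (ht : 0 < t) (x y : EuclideanSpace ℝ (Fin n)) :
    infConv quadL u t x ≤ u y + ‖y - x‖ ^ 2 / (2 * t) := by
  rw [infConv_quadL_eq ht]
  exact ciInf_le (bddBelow_infConv hb ht x) y

/-- The infimum in the Hopf-Lax formula is attained. -/
lemma exists_infConv_quadL_eq (hu : Continuous u) (hb : ∀ y, -C ≤ u y) (ht : 0 < t)
    (x : EuclideanSpace ℝ (Fin n)) :
    ∃ y, infConv quadL u t x = u y + ‖y - x‖ ^ 2 / (2 * t) := by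
  have hlim : Tendsto (fun y => u y + ‖y - x‖ ^ 2 / (2 * t))
      (cocompact (EuclideanSpace ℝ (Fin n))) atTop := by
    refine tendsto_atTop_add_left_of_le _ (-C) hb ?_
    refine Tendsto.atTop_div_const (by positivity) ?_
    refine (tendsto_pow_atTop two_ne_zero).comp ?_
    simpa only [dist_eq_norm] using tendsto_dist_right_cocompact_atTop x
  obtain ⟨y, hy⟩ := Continuous.exists_forall_le (by fun_prop) hlim
  refine ⟨y, le_antisymm (infConv_quadL_le hb ht x y) ?_⟩
  rw [infConv_quadL_eq ht]
  exact le_ciInf hy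

/-- The concave part of the infimal convolution, in the variables `s = 1 / t` and `p = x / t`. -/
noncomputable def concavePart (u : EuclideanSpace ℝ (Fin n) → ℝ) (q : ℝ × EuclideanSpace ℝ (Fin n)) : ℝ :=
  ⨅ y, (u y + q.1 * ‖y‖ ^ 2 / 2 - inner ℝ q.2 y)

lemma bddBelow_concavePart (hb : ∀ y, -C ≤ u y) {q : ℝ × EuclideanSpace ℝ (Fin n)}
    (hq : 0 < q.1) : BddBelow (range fun y => u y + q.1 * ‖y‖ ^ 2 / 2 - inner ℝ q.2 y) := by
  refine ⟨-C - ‖q.2‖ ^ 2 / (2 * q.1), ?_⟩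
  rintro _ ⟨y, rfl⟩
  have h1 := hb y
  have h2 := real_inner_le_norm q.2 y
  have h3 : ‖q.2‖ ^ 2 / (2 * q.1) + q.1 * ‖y‖ ^ 2 / 2 - ‖q.2‖ * ‖y‖
      = (‖q.2‖ - q.1 * ‖y‖) ^ 2 / (2 * q.1) := by field_simp; ring
  have h4 : 0 ≤ (‖q.2‖ - q.1 * ‖y‖) ^ 2 / (2 * q.1) := by positivity
  simp only; linarith

/-- An infimum of functions affine in `(s, p)` is concave. Concavity is joint in both variables,
which later yields continuity of `u_t(x)` in `(t, x)` together. -/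
lemma concaveOn_concavePart (hb : ∀ y, -C ≤ u y) :
    ConcaveOn ℝ (Ioi (0 : ℝ) ×ˢ (univ : Set (EuclideanSpace ℝ (Fin n)))) (concavePart u) := by
  refine ⟨(convex_Ioi 0).prod convex_univ, ?_⟩
  rintro ⟨s, p⟩ ⟨hs, -⟩ ⟨s', p'⟩ ⟨hs', -⟩ a b ha hb' hab
  refine le_ciInf fun y => ?_
  have h1 := mul_le_mul_of_nonneg_left (ciInf_le (bddBelow_concavePart hb (q := (s, p)) hs) y) ha
  have h2 := mul_le_mul_of_nonneg_left
    (ciInf_le (bddBelow_concavePart hb (q := (s', p')) hs') y) hb'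
  refine (add_le_add h1 h2).trans (le_of_eq ?_)
  simp only [Prod.fst_add, Prod.smul_fst, Prod.snd_add, Prod.smul_snd, smul_eq_mul, inner_add_left,
    real_inner_smul_left]
  linear_combination (u y) * hab

lemma infConv_eq_add_concavePart (hb : ∀ y, -C ≤ u y) (ht : 0 < t) (x : EuclideanSpace ℝ (Fin n)) :
    infConv quadL u t x = concavePart u (t⁻¹, t⁻¹ • x) + ‖x‖ ^ 2 / (2 * t) := by
  rw [infConv_quadL_eq ht, concavePart]
  have key : ∀ y, u y + ‖y - x‖ ^ 2 / (2 * t)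
      = (u y + t⁻¹ * ‖y‖ ^ 2 / 2 - inner ℝ (t⁻¹ • x) y) + ‖x‖ ^ 2 / (2 * t) := by
    intro y
    rw [norm_sub_sq_real, real_inner_smul_left, real_inner_comm]
    field_simp; ring
  simp_rw [key]
  exact ((OrderIso.addRight (‖x‖ ^ 2 / (2 * t))).map_ciInf
    (bddBelow_concavePart hb (q := (t⁻¹, t⁻¹ • x)) (inv_pos.2 ht))).symm

lemma continuousOn_infConv (hb : ∀ y, -C ≤ u y) :
    ContinuousOn (fun q : ℝ × EuclideanSpace ℝ (Fin n) => infConv quadL u q.1 q.2)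
      (Ioi 0 ×ˢ univ) := by
  have hc := (concaveOn_concavePart hb).continuousOn (isOpen_Ioi.prod isOpen_univ)
  have hm : ContinuousOn (fun q : ℝ × EuclideanSpace ℝ (Fin n) => (q.1⁻¹, q.1⁻¹ • q.2))
      (Ioi 0 ×ˢ univ) := by
    have : ContinuousOn (fun q : ℝ × EuclideanSpace ℝ (Fin n) => q.1⁻¹) (Ioi 0 ×ˢ univ) :=
      continuousOn_fst.inv₀ fun q hq => (ne_of_gt hq.1)
    exact this.prodMk (this.smul continuousOn_snd)
  have h1 := hc.comp hm fun q hq => ⟨inv_pos.2 (mem_Ioi.1 hq.1), mem_univ _⟩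
  have h2 : ContinuousOn (fun q : ℝ × EuclideanSpace ℝ (Fin n) => ‖q.2‖ ^ 2 / (2 * q.1))
      (Ioi 0 ×ˢ univ) :=
    ContinuousOn.div (by fun_prop) (by fun_prop) fun q hq => by
      have : (0 : ℝ) < q.1 := hq.1
      positivity
  exact (h1.add h2).congr fun q hq => infConv_eq_add_concavePart hb hq.1 q.2

lemma concaveOn_infConv_sub (hb : ∀ y, -C ≤ u y) (ht : 0 < t) :
    ConcaveOn ℝ univ fun x : EuclideanSpace ℝ (Fin n) =>
      infConv quadL u t x - ‖x‖ ^ 2 / (2 * t) := by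
  refine ⟨convex_univ, fun x _ y _ a b ha hb' hab => ?_⟩
  simp only [infConv_eq_add_concavePart hb ht, add_sub_cancel_right]
  have := (concaveOn_concavePart hb).2 (x := (t⁻¹, t⁻¹ • x)) ⟨inv_pos.2 ht, mem_univ _⟩
    (y := (t⁻¹, t⁻¹ • y)) ⟨inv_pos.2 ht, mem_univ _⟩ ha hb' hab
  refine this.trans (le_of_eq ?_)
  congr 1
  refine Prod.ext ?_ ?_
  · change a * t⁻¹ + b * t⁻¹ = t⁻¹
    rw [← add_mul, hab, one_mul]
  · change a • t⁻¹ • x + b • t⁻¹ • y = t⁻¹ • (a • x + b • y)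
    rw [smul_add, smul_comm a, smul_comm b]

/-- A finite concave function is locally Lipschitz, so Rademacher's theorem applies on countably
many neighbourhoods that cover the space. -/
lemma ae_differentiableAt_infConv (hb : ∀ y, -C ≤ u y) (ht : 0 < t) :
    ∀ᵐ x : EuclideanSpace ℝ (Fin n), DifferentiableAt ℝ (infConv quadL u t) x := by
  have hlip := (concaveOn_infConv_sub hb ht).locallyLipschitz
  have hae : ∀ᵐ x : EuclideanSpace ℝ (Fin n), DifferentiableAt ℝ
      (fun x => infConv quadL u t x - ‖x‖ ^ 2 / (2 * t)) x := by
    choose K s hs hK using hlip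
    obtain ⟨c, hc, hcU⟩ := TopologicalSpace.countable_cover_nhds (fun x => interior_mem_nhds.2 (hs x))
    have h : ∀ᵐ x : EuclideanSpace ℝ (Fin n), ∀ z ∈ c, x ∈ interior (s z) → DifferentiableAt ℝ
        (fun x => infConv quadL u t x - ‖x‖ ^ 2 / (2 * t)) x := by
      rw [ae_ball_iff hc]
      intro z _
      filter_upwards [((hK z).mono interior_subset).ae_differentiableWithinAt_of_mem] with x hx hxs
      exact (hx hxs).differentiableAt (isOpen_interior.mem_nhds hxs)
    filter_upwards [h] with x hx
    obtain ⟨z, hz, hxz⟩ := mem_iUnion₂.1 (hcU.symm ▸ mem_univ x : x ∈ ⋃ x ∈ c, interior (s x))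
    exact hx z hz hxz
  filter_upwards [hae] with x hx
  have h1 : DifferentiableAt ℝ (fun x : EuclideanSpace ℝ (Fin n) => ‖x‖ ^ 2) x :=
    (contDiff_norm_sq ℝ (n := 1)).differentiable one_ne_zero x
  have h2 : DifferentiableAt ℝ (fun x : EuclideanSpace ℝ (Fin n) => ‖x‖ ^ 2 / (2 * t)) x := by
    simpa only [div_eq_mul_inv] using h1.mul_const (2 * t)⁻¹
  exact (hx.add h2).congr_of_eventuallyEq (Eventually.of_forall fun z => by simp)

/-- Fubini exchanges the two quantifiers, once the set of `(t, x)` with differentiability in `x` is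
measurable; joint continuity supplies this. -/
lemma ae_ae_differentiableAt_infConv (hb : ∀ y, -C ≤ u y) :
    ∀ᵐ x : EuclideanSpace ℝ (Fin n), ∀ᵐ t ∂(volume.restrict (Ioi (0 : ℝ))),
      DifferentiableAt ℝ (infConv quadL u t) x := by
  have hcont : Continuous (Function.uncurry fun (t : Ioi (0 : ℝ)) (x : EuclideanSpace ℝ (Fin n)) =>
      infConv quadL u t x) := by
    refine (continuousOn_infConv hb).comp_continuous (f := fun q : Ioi (0 : ℝ) ×
      EuclideanSpace ℝ (Fin n) => ((q.1 : ℝ), q.2)) (by fun_prop) fun q => ⟨q.1.2, mem_univ _⟩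
  have hmeas := measurableSet_of_differentiableAt_with_param ℝ hcont
  -- Continuity holds only for `t > 0`, so measurability is obtained over the subtype and
  -- transported to `ℝ`.
  have hemb : MeasurableEmbedding (Prod.map ((↑) : Ioi (0 : ℝ) → ℝ)
      (id : EuclideanSpace ℝ (Fin n) → EuclideanSpace ℝ (Fin n))) :=
    (MeasurableEmbedding.subtype_coe measurableSet_Ioi).prodMap MeasurableEmbedding.id
  have hS : MeasurableSet {q : ℝ × EuclideanSpace ℝ (Fin n) |
      0 < q.1 → DifferentiableAt ℝ (infConv quadL u q.1) q.2} := by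
    have h1 : MeasurableSet {q : ℝ × EuclideanSpace ℝ (Fin n) | ¬ 0 < q.1} :=
      (measurableSet_lt measurable_const measurable_fst).compl
    refine (h1.union (hemb.measurableSet_image.2 hmeas)).congr ?_
    ext ⟨t, x⟩
    simp only [mem_union, mem_ofPred_eq, mem_image, Prod.exists, Prod.map_apply, id_eq,
      Prod.mk.injEq, Subtype.exists, mem_Ioi]
    constructor
    · rintro (h | ⟨t', ht', x', h, rfl, rfl⟩) h0
      · exact absurd h0 h
      · exact h
    · intro h
      by_cases h0 : 0 < t
      · exact Or.inr ⟨t, h0, x, h h0, rfl, rfl⟩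
      · exact Or.inl h0
  have h := (Measure.ae_ae_comm (μ := (volume : Measure ℝ))
    (ν := (volume : Measure (EuclideanSpace ℝ (Fin n))))
    (p := fun t x => 0 < t → DifferentiableAt ℝ (infConv quadL u t) x) hS).1 (Eventually.of_forall fun t => by
      by_cases ht : 0 < t
      · filter_upwards [ae_differentiableAt_infConv hb ht] with x hx _ using hx
      · exact Eventually.of_forall fun x h0 => absurd h0 ht)
  filter_upwards [h] with x hx
  rw [ae_restrict_iff' measurableSet_Ioi]
  exact hx

/-- At a point of differentiability, the gradient of `u_t` is read off from any minimizer. -/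
lemma gradient_infConv (hb : ∀ y, -C ≤ u y) (ht : 0 < t) {x y : EuclideanSpace ℝ (Fin n)}
    (hy : infConv quadL u t x = u y + ‖y - x‖ ^ 2 / (2 * t))
    (hd : DifferentiableAt ℝ (infConv quadL u t) x) :
    ∇ (infConv quadL u t) x = t⁻¹ • (x - y) := by
  set G := ∇ (infConv quadL u t) x
  have hdist : ∀ v, inner ℝ G v = inner ℝ (t⁻¹ • (x - y)) v := by
    intro v
    have hl : HasDerivAt (fun s : ℝ => x + s • v) v 0 := by
      simpa using ((hasDerivAt_id (0 : ℝ)).smul_const v).const_add x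
    have h1 : HasDerivAt (fun s : ℝ => infConv quadL u t (x + s • v)) (inner ℝ G v) 0 := by
      have := hd.hasGradientAt.hasFDerivAt
      rw [show x = x + (0 : ℝ) • v by simp] at this
      have := this.comp_hasDerivAt (0 : ℝ) hl
      simpa [G, Function.comp_def] using this
    have h2 : HasDerivAt (fun s : ℝ => u y + ‖y - (x + s • v)‖ ^ 2 / (2 * t))
        (inner ℝ (t⁻¹ • (x - y)) v) 0 := by
      have := (((hl.const_sub y).norm_sq).div_const (2 * t)).const_add (u y)
      refine this.congr_deriv ?_
      rw [real_inner_smul_left, inner_neg_right, ← inner_neg_left]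
      simp only [zero_smul, add_zero, neg_sub]
      field_simp
    -- The competitor `y` stays admissible at nearby points, with equality at `x`: the quadratic
    -- touches `u_t` from above, so both have the same derivative.
    have hmin : IsLocalMin (fun s : ℝ => (u y + ‖y - (x + s • v)‖ ^ 2 / (2 * t))
        - infConv quadL u t (x + s • v)) 0 := by
      refine Eventually.of_forall fun s => ?_
      have := infConv_quadL_le hb ht (x + s • v) y
      simp only [zero_smul, add_zero]
      linarith
    have := hmin.hasDerivAt_eq_zero (h2.sub h1)
    linarith
  exact ext_inner_right ℝ hdist

/-- The one-sided derivative of `u_t` in the direction of a minimizer exists and is large. -/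
lemma exists_hasDirDeriv_infConv (hb : ∀ y, -C ≤ u y) (ht : 0 < t)
    {x y : EuclideanSpace ℝ (Fin n)} (hxy : y ≠ x)
    (hy : infConv quadL u t x = u y + ‖y - x‖ ^ 2 / (2 * t)) :
    ∃ γ : EuclideanSpace ℝ (Fin n), ‖γ‖ = 1 ∧
      ∃ d : ℝ, HasDirDeriv (infConv quadL u t) d x γ ∧ ‖y - x‖ / t ≤ |d| := by
  have hpos : 0 < ‖y - x‖ := norm_pos_iff.2 (sub_ne_zero.2 hxy)
  set γ := ‖y - x‖⁻¹ • (y - x) with hγ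
  have hγ1 : ‖γ‖ = 1 := by
    rw [hγ, norm_smul, norm_inv, norm_norm, inv_mul_cancel₀ hpos.ne']
  have hl : HasDerivAt (fun s : ℝ => x + s • γ) γ 0 := by
    simpa using ((hasDerivAt_id (0 : ℝ)).smul_const γ).const_add x
  have hconc : ConvexOn ℝ univ fun s : ℝ =>
      -(infConv quadL u t (x + s • γ) - ‖x + s • γ‖ ^ 2 / (2 * t)) := by
    have := ((concaveOn_infConv_sub hb ht).comp_affineMap
      (AffineMap.lineMap x (x + γ) : ℝ →ᵃ[ℝ] EuclideanSpace ℝ (Fin n))).neg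
    rw [preimage_univ] at this
    refine this.congr fun s _ => ?_
    simp [AffineMap.lineMap_apply, add_comm]
  have h1 := (hconc.hasDerivWithinAt_rightDeriv_of_mem_interior
    (x := 0) (by simp)).neg.Ici_of_Ioi
  have h2 := (hl.norm_sq.div_const (2 * t)).hasDerivWithinAt (s := Ici 0)
  have h3 := h1.add h2
  set d := -derivWithin (fun s : ℝ =>
      -(infConv quadL u t (x + s • γ) - ‖x + s • γ‖ ^ 2 / (2 * t))) (Ioi 0) 0 +
      2 * inner ℝ (x + (0 : ℝ) • γ) γ / (2 * t)
  have hd : HasDirDeriv (infConv quadL u t) d x γ := by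
    refine h3.congr_of_eventuallyEq (Eventually.of_forall fun s => ?_) ?_ <;> simp
  refine ⟨γ, hγ1, d, hd, ?_⟩
  have h4 : HasDerivWithinAt (fun s : ℝ => u y + ‖y - (x + s • γ)‖ ^ 2 / (2 * t))
      (-(‖y - x‖ / t)) (Ici 0) 0 := by
    have := ((((hl.const_sub y).norm_sq).div_const (2 * t)).const_add (u y)).hasDerivWithinAt
      (s := Ici 0)
    refine this.congr_deriv ?_
    rw [inner_neg_right, hγ]
    simp only [zero_smul, add_zero, real_inner_smul_right, real_inner_self_eq_norm_sq]
    field_simp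
  have h5 := (h4.sub hd)
  -- Touching from above bounds the right derivative `d` by the slope `-‖y - x‖ / t` of the
  -- quadratic.
  have h6 : 0 ≤ -(‖y - x‖ / t) - d := by
    have h7 := (hasDerivWithinAt_iff_tendsto_slope' self_notMem_Ioi).1
      (h5.mono Ioi_subset_Ici_self)
    refine ge_of_tendsto h7 (eventually_mem_nhdsWithin.mono fun s hs => ?_)
    have h8 := infConv_quadL_le hb ht (x + s • γ) y
    rw [slope_def_field]
    refine div_nonneg ?_ (sub_nonneg.2 (le_of_lt hs))
    simp only [Pi.sub_apply, zero_smul, add_zero]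
    linarith
  have := neg_abs_le d
  linarith

end InfConv

/-! ### Logarithmic cut-offs of small `n`-energy -/

section Spike

lemma exists_abs_deriv_smoothTransition_le :
    ∃ K : ℝ, 0 < K ∧ ∀ x, |deriv Real.smoothTransition x| ≤ K := by
  have hc : Continuous (deriv Real.smoothTransition) :=
    (Real.smoothTransition.contDiff (n := 1)).continuous_deriv le_rfl
  obtain ⟨K, hK⟩ := isCompact_Icc.exists_bound_of_continuousOn (s := Icc (0 : ℝ) 1) hc.continuousOn
  refine ⟨max K 1, by positivity, fun x => ?_⟩
  by_cases hx0 : x < 0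
  · have : Real.smoothTransition =ᶠ[𝓝 x] fun _ => 0 := by
      filter_upwards [Iio_mem_nhds hx0] with z hz
      exact Real.smoothTransition.zero_of_nonpos (le_of_lt hz)
    rw [this.deriv_eq]
    simp
  by_cases hx1 : 1 < x
  · have : Real.smoothTransition =ᶠ[𝓝 x] fun _ => 1 := by
      filter_upwards [Ioi_mem_nhds hx1] with z hz
      exact Real.smoothTransition.one_of_one_le (le_of_lt hz)
    rw [this.deriv_eq]
    simp
  · exact (hK x ⟨not_lt.1 hx0, not_lt.1 hx1⟩).trans (le_max_left _ _)

lemma integral_id_div_sq_add_sq {ε η : ℝ} (hη : 0 < η) :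
    ∫ y in (0 : ℝ)..ε, y / (y ^ 2 + η ^ 2)
      = (Real.log (ε ^ 2 + η ^ 2) - Real.log (η ^ 2)) / 2 := by
  have hd : ∀ y : ℝ, HasDerivAt (fun y => Real.log (y ^ 2 + η ^ 2) / 2) (y / (y ^ 2 + η ^ 2)) y := by
    intro y
    have h0 : y ^ 2 + η ^ 2 ≠ 0 := by positivity
    have := ((((hasDerivAt_id y).pow 2).add_const (η ^ 2)).log h0).div_const 2
    refine this.congr_deriv ?_
    simp only [Pi.pow_apply, id, Nat.cast_ofNat, Nat.add_one_sub_one, pow_one]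
    field_simp
  have hc : Continuous fun y : ℝ => y / (y ^ 2 + η ^ 2) :=
    continuous_id.div (by fun_prop) fun y => by positivity
  rw [intervalIntegral.integral_eq_sub_of_hasDerivAt (fun y _ => hd y) (hc.intervalIntegrable _ _)]
  simp
  ring

variable {n : ℕ}

/-- A smooth version of the logarithmic cut-off `x ↦ log (ε / ‖x‖) / L`. -/
noncomputable def logSpike (ε η L : ℝ) (x : EuclideanSpace ℝ (Fin n)) : ℝ :=
  Real.smoothTransition ((Real.log (ε ^ 2) - Real.log (‖x‖ ^ 2 + η ^ 2)) / L)

lemma contDiff_logSpike {ε η L : ℝ} (hη : 0 < η) :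
    ContDiff ℝ 1 (logSpike (n := n) ε η L) := by
  refine Real.smoothTransition.contDiff.comp (ContDiff.div_const (contDiff_const.sub ?_) _)
  exact ((contDiff_norm_sq ℝ).add contDiff_const).log fun x => by positivity

lemma norm_gradient_logSpike_le {ε η L K : ℝ} (hη : 0 < η) (hL : 0 < L)
    (hK : ∀ x, |deriv Real.smoothTransition x| ≤ K) (x : EuclideanSpace ℝ (Fin n)) :
    ‖∇ (logSpike ε η L) x‖ ≤ 2 * K / L * (‖x‖ / (‖x‖ ^ 2 + η ^ 2)) := by
  have hK0 : 0 ≤ K := (abs_nonneg _).trans (hK 0)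
  have h0 : ‖x‖ ^ 2 + η ^ 2 ≠ 0 := by positivity
  have h1 := ((((hasStrictFDerivAt_norm_sq x).hasFDerivAt.add_const (η ^ 2)).log h0).const_sub
    (Real.log (ε ^ 2))).mul_const L⁻¹
  have h2 := ((Real.smoothTransition.contDiff (n := 1)).differentiable one_ne_zero
    ((Real.log (ε ^ 2) - Real.log (‖x‖ ^ 2 + η ^ 2)) * L⁻¹)).hasDerivAt.comp_hasFDerivAt x h1
  have h3 : ‖∇ (logSpike ε η L) x‖ = ‖fderiv ℝ (logSpike ε η L) x‖ :=
    (InnerProductSpace.toDual ℝ (EuclideanSpace ℝ (Fin n))).symm.norm_map _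
  have h4 : fderiv ℝ (logSpike ε η L) x = _ :=
    (h2.congr_of_eventuallyEq (Eventually.of_forall fun z => by
      simp [logSpike, div_eq_mul_inv])).fderiv
  rw [h3, h4]
  have h5 : ‖(2 : ℕ) • innerSL ℝ x‖ = 2 * ‖x‖ := by
    rw [RCLike.norm_nsmul ℝ, innerSL_apply_norm, nsmul_eq_mul, Nat.cast_ofNat]
  rw [norm_smul, norm_smul, norm_neg, norm_smul, h5, norm_inv, norm_inv,
    Real.norm_of_nonneg hL.le, Real.norm_of_nonneg (by positivity : 0 ≤ ‖x‖ ^ 2 + η ^ 2)]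
  refine (mul_le_mul_of_nonneg_right (hK _) (by positivity)).trans (le_of_eq ?_)
  field_simp

/-- Zero is the global minimum of the cut-off, so the gradient vanishes wherever the value does,
including on the sphere of radius `ε`. -/
lemma gradient_logSpike_eq_zero {ε η L : ℝ} (hε : 0 < ε) (hη : 0 < η) (hL : 0 < L)
    {x : EuclideanSpace ℝ (Fin n)} (hx : ε ≤ ‖x‖) :
    logSpike ε η L x = 0 ∧ ∇ (logSpike ε η L) x = 0 := by
  have h0 : logSpike ε η L x = 0 := by
    refine Real.smoothTransition.zero_of_nonpos (div_nonpos_of_nonpos_of_nonneg ?_ hL.le)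
    rw [sub_nonpos]
    refine Real.log_le_log (by positivity) ?_
    nlinarith
  refine ⟨h0, ?_⟩
  have hmin : IsLocalMin (logSpike ε η L) x :=
    Eventually.of_forall fun z => h0.trans_le (Real.smoothTransition.nonneg _)
  rw [gradient, hmin.fderiv_eq_zero, map_zero]

lemma setIntegral_ball_fun_norm (hn : n ≠ 0) (g : ℝ → ℝ) (ε : ℝ) :
    ∫ x in Metric.ball (0 : EuclideanSpace ℝ (Fin n)) ε, g ‖x‖
      = n * (volume.real (Metric.ball (0 : EuclideanSpace ℝ (Fin n)) 1) *
        ∫ y in Ioo 0 ε, y ^ (n - 1) * g y) := by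
  have : Nonempty (Fin n) := Fin.pos_iff_nonempty.1 (Nat.pos_of_ne_zero hn)
  have h := integral_fun_norm_addHaar (volume : Measure (EuclideanSpace ℝ (Fin n)))
    ((Iio ε).indicator g)
  simp only [finrank_euclideanSpace, Fintype.card_fin, nsmul_eq_mul, smul_eq_mul] at h
  rw [← integral_indicator Metric.isOpen_ball.measurableSet]
  have e1 : (fun x : EuclideanSpace ℝ (Fin n) => (Iio ε).indicator g ‖x‖)
      = (Metric.ball 0 ε).indicator fun x => g ‖x‖ := by
    ext x; simp [indicator]
  have e2 : ∫ y in Ioi (0 : ℝ), y ^ (n - 1) * (Iio ε).indicator g y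
      = ∫ y in Ioo 0 ε, y ^ (n - 1) * g y := by
    have : (fun y => y ^ (n - 1) * (Iio ε).indicator g y)
        = (Iio ε).indicator fun y => y ^ (n - 1) * g y := by
      ext y; simp [indicator]
    rw [this, setIntegral_indicator measurableSet_Iio, Ioi_inter_Iio]
  rw [← e1, h, e2]

/-- In polar coordinates the energy density is at most a multiple of `y / (y ^ 2 + η ^ 2)`, because
`y ^ 2 / (y ^ 2 + η ^ 2) ≤ 1`. The energy thus grows only logarithmically as `η → 0`. -/
lemma integral_pow_div_le (hn : 2 ≤ n) {ε η c : ℝ} (hε : 0 < ε) (hη : 0 < η) (hc : 0 ≤ c) :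
    ∫ y in Ioo 0 ε, y ^ (n - 1) * (c * (y / (y ^ 2 + η ^ 2))) ^ n
      ≤ c ^ n * ((Real.log (ε ^ 2 + η ^ 2) - Real.log (η ^ 2)) / 2) := by
  have hcont : Continuous fun y : ℝ => y / (y ^ 2 + η ^ 2) :=
    continuous_id.div (by fun_prop) fun y => by positivity
  rw [← integral_id_div_sq_add_sq hη, ← intervalIntegral.integral_const_mul,
    intervalIntegral.integral_of_le hε.le, integral_Ioc_eq_integral_Ioo]
  have hI : ∀ F : ℝ → ℝ, Continuous F → IntegrableOn F (Ioo 0 ε) := fun F hF =>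
    (hF.integrableOn_Icc (a := 0) (b := ε)).mono_set Ioo_subset_Icc_self
  refine setIntegral_mono_on (hI _ (by fun_prop)) (hI _ (by fun_prop)) measurableSet_Ioo ?_
  intro y hy
  have hy0 : 0 < y := hy.1
  obtain ⟨m, rfl⟩ : ∃ m, n = m + 2 := ⟨n - 2, by omega⟩
  have hq : 0 < y ^ 2 + η ^ 2 := by positivity
  have h1 : y ^ 2 / (y ^ 2 + η ^ 2) ≤ 1 := by
    rw [div_le_one hq]; nlinarith [sq_nonneg η]
  have h2 : (y ^ 2 / (y ^ 2 + η ^ 2)) ^ (m + 1) ≤ 1 := pow_le_one₀ (by positivity) h1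
  have h3 : y ^ (m + 2 - 1) * (c * (y / (y ^ 2 + η ^ 2))) ^ (m + 2)
      = c ^ (m + 2) * (y / (y ^ 2 + η ^ 2)) * (y ^ 2 / (y ^ 2 + η ^ 2)) ^ (m + 1) := by
    rw [show m + 2 - 1 = m + 1 by omega]
    simp only [mul_pow, div_pow]
    field_simp
    ring
  rw [h3]
  exact mul_le_of_le_one_right (by positivity) h2

/-- Points have zero `n`-capacity in dimension `n ≥ 2`. -/
lemma exists_spike (hn : 2 ≤ n) {ε δ : ℝ} (hε : 0 < ε) (hδ : 0 < δ) :
    ∃ f : EuclideanSpace ℝ (Fin n) → ℝ, ContDiff ℝ 1 f ∧ (∀ x, 0 ≤ f x) ∧ (∀ x, f x ≤ 1) ∧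
      f 0 = 1 ∧ (∀ x, ε ≤ ‖x‖ → f x = 0 ∧ ∇ f x = 0) ∧
      eLpNorm (∇ f) n volume ≤ ENNReal.ofReal δ := by
  obtain ⟨K, hK0, hK⟩ := exists_abs_deriv_smoothTransition_le
  set ν := volume.real (Metric.ball (0 : EuclideanSpace ℝ (Fin n)) 1)
  have hν : 0 ≤ ν := measureReal_nonneg
  set A : ℝ := n * (ν * (2 * K) ^ n)
  have hA : 0 ≤ A := by positivity
  -- The energy will be at most `A / L`. The choice of `η` below makes `log (ε ^ 2 / η ^ 2) = L`, so
  -- that the cut-off equals one at the origin.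
  set L : ℝ := max 1 (A / δ ^ n)
  have hL1 : 1 ≤ L := le_max_left _ _
  have hL : 0 < L := by linarith
  have hAL : A / L ≤ δ ^ n := by
    rw [div_le_comm₀ hL (by positivity)]
    exact le_max_right _ _
  set η : ℝ := ε * Real.exp (-L / 2)
  have hη : 0 < η := by positivity
  have hη2 : η ^ 2 = ε ^ 2 * Real.exp (-L) := by
    rw [mul_pow, ← Real.exp_nat_mul]; congr 2; push_cast; ring
  have hlog : Real.log (η ^ 2) = Real.log (ε ^ 2) - L := by
    rw [hη2, Real.log_mul (by positivity) (by positivity), Real.log_exp]; ring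
  have hlog2 : Real.log (ε ^ 2 + η ^ 2) ≤ Real.log (ε ^ 2) + 1 := by
    have h1 : ε ^ 2 + η ^ 2 ≤ ε ^ 2 * Real.exp 1 := by
      have h2 : Real.exp (-L) ≤ 1 := Real.exp_le_one_iff.2 (by linarith)
      have h3 := Real.add_one_le_exp 1
      rw [hη2]
      nlinarith [sq_nonneg ε]
    calc _ ≤ Real.log (ε ^ 2 * Real.exp 1) := Real.log_le_log (by positivity) h1
      _ = _ := by rw [Real.log_mul (by positivity) (by positivity), Real.log_exp]
  refine ⟨logSpike ε η L, contDiff_logSpike hη, fun x => Real.smoothTransition.nonneg _,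
    fun x => Real.smoothTransition.le_one _, ?_, fun x => gradient_logSpike_eq_zero hε hη hL, ?_⟩
  · refine Real.smoothTransition.one_of_one_le ?_
    rw [norm_zero, zero_pow two_ne_zero, zero_add, hlog, sub_sub_cancel, div_self hL.ne']
  have hn0 : (n : ℝ≥0∞) ≠ 0 := by simp; omega
  set g : ℝ → ℝ := fun y => (2 * K / L * (y / (y ^ 2 + η ^ 2))) ^ n
  have hg : Continuous g := by
    have : Continuous fun y : ℝ => y / (y ^ 2 + η ^ 2) :=
      continuous_id.div (by fun_prop) fun y => by positivity
    fun_prop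
  have hint : ∫ x in Metric.ball (0 : EuclideanSpace ℝ (Fin n)) ε, g ‖x‖ ≤ δ ^ n := by
    rw [setIntegral_ball_fun_norm (by omega) g ε]
    have h1 := integral_pow_div_le hn (c := 2 * K / L) hε hη (by positivity)
    refine le_trans ?_ hAL
    have h2 : (2 * K / L) ^ n * ((Real.log (ε ^ 2 + η ^ 2) - Real.log (η ^ 2)) / 2)
        ≤ (2 * K) ^ n / L := by
      have h3 : (Real.log (ε ^ 2 + η ^ 2) - Real.log (η ^ 2)) / 2 ≤ L := by linarith
      -- This is where `n ≥ 2` matters: the factor `L⁻ⁿ` beats the logarithm `L`.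
      have h4 : (2 * K / L) ^ n * L ≤ (2 * K) ^ n / L := by
        rw [div_pow, div_mul_eq_mul_div, div_le_div_iff₀ (by positivity) hL, mul_assoc]
        gcongr
        calc L * L = L ^ 2 := by ring
          _ ≤ L ^ n := pow_le_pow_right₀ hL1 hn
      exact (mul_le_mul_of_nonneg_left h3 (by positivity)).trans h4
    calc _ ≤ n * (ν * ((2 * K) ^ n / L)) := by
          gcongr
          exact h1.trans h2
      _ = A / L := by simp only [A]; ring
  rw [eLpNorm_eq_lintegral_rpow_enorm_toReal hn0 (ENNReal.natCast_ne_top n), ENNReal.toReal_natCast]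
  rw [one_div, ENNReal.rpow_inv_le_iff (by positivity), ENNReal.rpow_natCast,
    ← ENNReal.ofReal_pow hδ.le]
  refine le_trans ?_ (ENNReal.ofReal_le_ofReal hint)
  rw [ofReal_integral_eq_lintegral_ofReal]
  · rw [← lintegral_indicator Metric.isOpen_ball.measurableSet]
    refine lintegral_mono fun x => ?_
    by_cases hx : ε ≤ ‖x‖
    · rw [(gradient_logSpike_eq_zero hε hη hL hx).2, enorm_zero, ENNReal.rpow_natCast,
        zero_pow (by omega)]
      exact zero_le
    · rw [indicator_of_mem (by simpa using hx), ENNReal.rpow_natCast, ← ofReal_norm,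
        ← ENNReal.ofReal_pow (norm_nonneg _)]
      refine ENNReal.ofReal_le_ofReal ?_
      exact pow_le_pow_left₀ (norm_nonneg _) (norm_gradient_logSpike_le hη hL hK x) n
  · exact ((hg.comp continuous_norm).continuousOn.integrableOn_compact
      (isCompact_closedBall 0 ε)).mono_set Metric.ball_subset_closedBall
  · exact Eventually.of_forall fun x => by positivity

end Spike

/-! ### Weak differentiation of a series -/

section WeakGradient

variable {n : ℕ}

lemma continuous_gradient {f : EuclideanSpace ℝ (Fin n) → ℝ} (hf : ContDiff ℝ 1 f) :
    Continuous (∇ f) :=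
  (InnerProductSpace.toDual ℝ (EuclideanSpace ℝ (Fin n))).symm.continuous.comp
    (hf.continuous_fderiv one_ne_zero)

lemma integral_mul_fderiv_eq_neg_inner_gradient {f φ : EuclideanSpace ℝ (Fin n) → ℝ}
    (hf : ContDiff ℝ 1 f) (hφ : ContDiff ℝ ∞ φ) (hφc : HasCompactSupport φ)
    (w : EuclideanSpace ℝ (Fin n)) :
    ∫ x, f x * fderiv ℝ φ x w = - ∫ x, inner ℝ (∇ f x) w * φ x := by
  have hφ' : Continuous fun x => fderiv ℝ φ x w :=
    (hφ.continuous_fderiv (by simp)).clm_apply continuous_const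
  have hf' : Continuous fun x => fderiv ℝ f x w :=
    (hf.continuous_fderiv one_ne_zero).clm_apply continuous_const
  simp_rw [inner_gradient_left]
  refine integral_mul_fderiv_eq_neg_fderiv_mul_of_integrable ?_ ?_ ?_
    (fun x _ => hf.differentiable one_ne_zero x) (fun x _ => hφ.differentiable (by simp) x)
  · exact (hf'.mul hφ.continuous).integrable_of_hasCompactSupport hφc.mul_left
  · exact (hf.continuous.mul hφ').integrable_of_hasCompactSupport
      ((hφc.fderiv_apply (𝕜 := ℝ) w).mul_left)
  · exact (hf.continuous.mul hφ.continuous).integrable_of_hasCompactSupport hφc.mul_left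

/-- A uniformly convergent series of `C¹` functions supported in a fixed ball, whose gradients
are summable in `Lᵖ`, can be differentiated weakly term by term. -/
lemma hasWeakGradient_tsum {v : ℕ → EuclideanSpace ℝ (Fin n) → ℝ} {R : ℝ} {h : ℕ → ℝ} {p : ℝ≥0∞}
    (hp : 1 ≤ p) (hv : ∀ k, ContDiff ℝ 1 (v k))
    (hsupp : ∀ k x, R ≤ ‖x‖ → v k x = 0 ∧ ∇ (v k) x = 0)
    (hh : Summable h) (hvh : ∀ k x, |v k x| ≤ h k)
    (hgrad : ∑' k, eLpNorm (∇ (v k)) p volume ≠ ⊤) :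
    ∃ g : EuclideanSpace ℝ (Fin n) → EuclideanSpace ℝ (Fin n),
      HasWeakGradient (fun x => ∑' k, v k x) g ∧ MemLp g p volume ∧ ∀ x, R ≤ ‖x‖ → g x = 0 := by
  have hgc := fun k => continuous_gradient (hv k)
  have hgm : ∀ k, AEStronglyMeasurable (∇ (v k)) volume := fun k => (hgc k).aestronglyMeasurable
  have hsum : ∀ᵐ x, Summable fun k => ∇ (v k) x := by
    filter_upwards [summable_norm_of_tsum_eLpNorm_ne_top hp hgm hgrad] with x hx using hx.of_norm
  have htend : ∀ᵐ x, Tendsto (fun N => (∑ k ∈ Finset.range N, ∇ (v k)) x) atTop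
      (𝓝 (∑' k, ∇ (v k) x)) := by
    filter_upwards [hsum] with x hx
    simpa only [Finset.sum_apply] using hx.hasSum.tendsto_sum_nat
  have hSm : ∀ N, AEStronglyMeasurable (∑ k ∈ Finset.range N, ∇ (v k)) volume := fun N =>
    Finset.aestronglyMeasurable_sum _ fun k _ => hgm k
  have hgLp : MemLp (fun x => ∑' k, ∇ (v k) x) p volume := by
    refine ⟨aestronglyMeasurable_of_tendsto_ae atTop hSm htend, ?_⟩
    -- Fatou's lemma on the partial sums, then Minkowski's inequality.
    refine (Lp.eLpNorm_lim_le_liminf_eLpNorm hSm _ htend).trans_lt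
      (lt_of_le_of_lt ?_ hgrad.lt_top)
    refine liminf_le_of_le (by isBoundedDefault) fun b hb => ?_
    obtain ⟨N, hN⟩ := hb.exists
    exact hN.trans ((eLpNorm_sum_le (fun k _ => hgm k) hp).trans (ENNReal.sum_le_tsum _))
  have hcont : Continuous fun x => ∑' k, v k x :=
    continuous_tsum (fun k => (hv k).continuous) hh hvh
  refine ⟨_, ⟨hcont.locallyIntegrable, hgLp.locallyIntegrable hp, ?_⟩, hgLp, fun x hx => ?_⟩
  swap
  · simp [(hsupp _ x hx).2]
  intro φ hφ hφc w
  have hφ' : Continuous fun x => fderiv ℝ φ x w :=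
    (hφ.continuous_fderiv (by simp)).clm_apply continuous_const
  have hφ'c : HasCompactSupport fun x => fderiv ℝ φ x w := hφc.fderiv_apply (𝕜 := ℝ) w
  obtain ⟨C, hC⟩ := hφ.continuous.bounded_above_of_compact_support hφc
  have hC0 : 0 ≤ C := (norm_nonneg _).trans (hC 0)
  have hgi : ∀ k, Integrable (∇ (v k)) volume := fun k =>
    (hgc k).integrable_of_hasCompactSupport
      (HasCompactSupport.intro (isCompact_closedBall 0 R) fun x hx =>
        (hsupp k x (by simpa using (not_le.1 (by simpa using hx)).le)).2)
  -- On the common ball Hölder's inequality bounds the `L¹` norms by the `Lᵖ` norms with a factor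
  -- independent of `k`. This justifies integrating the gradient series term by term.
  have hL1 : Summable fun k => ∫ x, ‖∇ (v k) x‖ := by
    set B := Metric.closedBall (0 : EuclideanSpace ℝ (Fin n)) R
    have hB : volume B ≠ ⊤ := (isCompact_closedBall _ _).measure_lt_top.ne
    set c := (volume.restrict B) univ ^ (1 / (1 : ℝ≥0∞).toReal - 1 / p.toReal)
    have hc : c ≠ ⊤ := by
      refine ENNReal.rpow_ne_top_of_nonneg ?_ (by simpa using hB)
      rcases eq_or_ne p ⊤ with rfl | hp'
      · simp
      · have : 1 ≤ p.toReal := by simpa using ENNReal.toReal_mono hp' hp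
        simpa using inv_le_one_of_one_le₀ this
    have hk : ∀ k, eLpNorm (∇ (v k)) 1 volume ≤ eLpNorm (∇ (v k)) p volume * c := by
      intro k
      have hs : (∇ (v k)).support ⊆ B := fun x hx => by
        by_contra hxB
        exact hx (hsupp k x (by simpa using (not_le.1 (by simpa [B] using hxB)).le)).2
      rw [← eLpNorm_restrict_eq_of_support_subset hs]
      refine (eLpNorm_le_eLpNorm_mul_rpow_measure_univ hp (hgm k).restrict).trans ?_
      rw [eLpNorm_restrict_eq_of_support_subset hs]
    have hfin : ∑' k, eLpNorm (∇ (v k)) 1 volume ≠ ⊤ := by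
      refine ne_top_of_le_ne_top ?_ (ENNReal.tsum_le_tsum hk)
      rw [ENNReal.tsum_mul_right]
      exact ENNReal.mul_ne_top hgrad hc
    refine (ENNReal.summable_toReal hfin).congr fun k => ?_
    rw [eLpNorm_one_eq_lintegral_enorm, integral_norm_eq_lintegral_enorm (hgm k)]
  have h1 := hasSum_integral_of_summable_integral_norm (μ := volume)
    (F := fun k x => v k x * fderiv ℝ φ x w)
    (fun k => ((hv k).continuous.mul hφ').integrable_of_hasCompactSupport hφ'c.mul_left) (by
      refine Summable.of_nonneg_of_le (fun k => integral_nonneg fun x => norm_nonneg _)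
        (fun k => ?_) (hh.mul_right (∫ x, ‖fderiv ℝ φ x w‖))
      rw [← integral_const_mul]
      refine integral_mono_of_nonneg (Eventually.of_forall fun x => norm_nonneg _)
        (((hφ'.integrable_of_hasCompactSupport hφ'c).norm).const_mul _)
        (Eventually.of_forall fun x => ?_)
      simp only [norm_mul]
      exact mul_le_mul_of_nonneg_right (hvh k x) (norm_nonneg _))
  have hGc : ∀ k, Continuous fun x => inner ℝ (∇ (v k) x) w * φ x := fun k =>
    ((hgc k).inner continuous_const).mul hφ.continuous
  have h2 := hasSum_integral_of_summable_integral_norm (μ := volume)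
    (F := fun k x => inner ℝ (∇ (v k) x) w * φ x)
    (fun k => (hGc k).integrable_of_hasCompactSupport hφc.mul_left) (by
      refine Summable.of_nonneg_of_le (fun k => integral_nonneg fun x => norm_nonneg _)
        (fun k => ?_) (hL1.mul_right (‖w‖ * C))
      rw [← integral_mul_const]
      refine integral_mono_of_nonneg (Eventually.of_forall fun x => norm_nonneg _)
        ((hgi k).norm.mul_const _) (Eventually.of_forall fun x => ?_)
      simp only [norm_mul]
      rw [← mul_assoc]
      exact mul_le_mul (norm_inner_le_norm _ _) (hC x) (norm_nonneg _) (by positivity))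
  have h3 : ∫ x, inner ℝ (∑' k, ∇ (v k) x) w * φ x
      = ∫ x, ∑' k, inner ℝ (∇ (v k) x) w * φ x := by
    refine integral_congr_ae ?_
    filter_upwards [hsum] with x hx
    rw [tsum_mul_right]
    congr 1
    rw [real_inner_comm, ← innerSL_apply_apply ℝ, (innerSL ℝ w).map_tsum hx]
    exact tsum_congr fun k => by rw [innerSL_apply_apply, real_inner_comm]
  simp_rw [tsum_mul_right] at h1
  rw [h3]
  refine h1.unique ?_
  simpa only [integral_mul_fderiv_eq_neg_inner_gradient (hv _) hφ hφc w] using h2.neg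

lemma memW1p_of_le {u : EuclideanSpace ℝ (Fin n) → ℝ}
    {g : EuclideanSpace ℝ (Fin n) → EuclideanSpace ℝ (Fin n)} {R : ℝ} {p q : ℝ≥0∞}
    (hu : Continuous u) (hg : HasWeakGradient u g) (hgq : MemLp g q volume)
    (hsu : ∀ x, R ≤ ‖x‖ → u x = 0) (hsg : ∀ x, R ≤ ‖x‖ → g x = 0) (hpq : p ≤ q) :
    MemW1p u p := by
  have hout : ∀ x ∉ Metric.closedBall (0 : EuclideanSpace ℝ (Fin n)) R, R ≤ ‖x‖ := fun x hx => by
    simpa using (not_le.1 (by simpa using hx)).le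
  refine ⟨hu.memLp_of_hasCompactSupport
    (HasCompactSupport.intro (isCompact_closedBall 0 R) fun x hx => hsu x (hout x hx)), g, hg, ?_⟩
  set B := Metric.closedBall (0 : EuclideanSpace ℝ (Fin n)) R
  have hB : volume B ≠ ⊤ := (isCompact_closedBall _ _).measure_lt_top.ne
  exact hgq.mono_exponent_of_measure_support_ne_top (s := B) (fun x hx => hsg x (hout x hx)) hB hpq

end WeakGradient

/-! ### Spikes on a grid -/

section Grid

variable {n : ℕ}

/-- Integer vectors with all coordinates in `[-M, M)`. -/
noncomputable def gridIndex (n M : ℕ) : Finset (Fin n → ℤ) :=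
  Fintype.piFinset fun _ => Finset.Ico (-(M : ℤ)) M

/-- The point `z / M` of the grid of mesh `1 / M`. -/
noncomputable def gridPoint (M : ℕ) (z : Fin n → ℤ) : EuclideanSpace ℝ (Fin n) :=
  WithLp.toLp 2 fun i => (z i : ℝ) / M

lemma card_gridIndex (n M : ℕ) : (gridIndex n M).card = (2 * M) ^ n := by
  rw [gridIndex, Fintype.card_piFinset]
  simp only [Int.card_Ico, Finset.prod_const, Finset.card_univ, Fintype.card_fin]
  congr 1; omega

lemma exists_gridPoint_near {M : ℕ} (hM : 0 < M) {x : EuclideanSpace ℝ (Fin n)} (hx : ‖x‖ < 1) :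
    ∃ z ∈ gridIndex n M, ‖gridPoint M z - x‖ ^ 2 ≤ n / (M : ℝ) ^ 2 := by
  have hM' : (0 : ℝ) < M := by exact_mod_cast hM
  refine ⟨fun i => ⌊M * x i⌋, ?_, ?_⟩
  · rw [gridIndex, Fintype.mem_piFinset]
    intro i
    have h1 : |x i| < 1 := (PiLp.norm_apply_le x i).trans_lt hx
    rw [abs_lt] at h1
    rw [Finset.mem_Ico, Int.le_floor, Int.floor_lt]
    push_cast
    constructor <;> nlinarith
  · rw [EuclideanSpace.norm_sq_eq]
    calc ∑ i, ‖(gridPoint M (fun i => ⌊M * x i⌋) - x) i‖ ^ 2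
        ≤ ∑ _i : Fin n, (1 / (M : ℝ)) ^ 2 := by
          refine Finset.sum_le_sum fun i _ => ?_
          refine pow_le_pow_left₀ (norm_nonneg _) ?_ 2
          have e : (gridPoint M (fun i => ⌊M * x i⌋) - x) i = (⌊M * x i⌋ - M * x i) / M := by
            simp only [gridPoint, PiLp.sub_apply]
            field_simp
          rw [e, Real.norm_eq_abs, abs_div, abs_of_pos hM']
          gcongr
          have h1 := Int.floor_le (M * x i)
          have h2 := Int.lt_floor_add_one (M * x i)
          rw [abs_le]
          constructor <;> linarith
      _ = n / (M : ℝ) ^ 2 := by simp [div_eq_mul_inv]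

lemma le_norm_gridPoint_sub {M : ℕ} {z z' : Fin n → ℤ} (h : z ≠ z') :
    1 / (M : ℝ) ≤ ‖gridPoint M z - gridPoint M z'‖ := by
  obtain ⟨i, hi⟩ := Function.ne_iff.1 h
  refine le_trans ?_ (PiLp.norm_apply_le (gridPoint M z - gridPoint M z') i)
  have e : (gridPoint M z - gridPoint M z') i = ((z i - z' i : ℤ) : ℝ) / M := by
    simp only [gridPoint, PiLp.sub_apply]
    push_cast; ring
  rw [e, Real.norm_eq_abs, abs_div, Nat.abs_cast]
  gcongr
  exact_mod_cast Int.one_le_abs (sub_ne_zero.2 hi)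

lemma norm_gridPoint_le {M : ℕ} (hM : 0 < M) {z : Fin n → ℤ} (hz : z ∈ gridIndex n M) :
    ‖gridPoint M z‖ ≤ n := by
  have hM' : (0 : ℝ) < M := by exact_mod_cast hM
  rw [gridIndex, Fintype.mem_piFinset] at hz
  have h1 : ‖gridPoint M z‖ ^ 2 ≤ n := by
    rw [EuclideanSpace.norm_sq_eq]
    calc ∑ i, ‖gridPoint M z i‖ ^ 2 ≤ ∑ _i : Fin n, (1 : ℝ) := by
          refine Finset.sum_le_sum fun i _ => pow_le_one₀ (norm_nonneg _) ?_
          have h2 := Finset.mem_Ico.1 (hz i)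
          have h3 : |(z i : ℝ)| ≤ M := by
            rw [abs_le]
            exact ⟨by exact_mod_cast h2.1, by exact_mod_cast h2.2.le⟩
          simp only [gridPoint]
          rw [Real.norm_eq_abs, abs_div, Nat.abs_cast]
          exact (div_le_one hM').2 h3
      _ = n := by simp
  have h2 : (n : ℝ) ≤ (n : ℝ) ^ 2 := by exact_mod_cast Nat.le_self_pow two_ne_zero n
  exact le_of_sq_le_sq (h1.trans h2) (Nat.cast_nonneg n)

lemma gradient_const_mul_sum_translate {ι : Type*} (s : Finset ι)
    (P : ι → EuclideanSpace ℝ (Fin n)) (c : ℝ) {f : EuclideanSpace ℝ (Fin n) → ℝ}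
    (hf : Differentiable ℝ f) (x : EuclideanSpace ℝ (Fin n)) :
    ∇ (fun x => c * ∑ i ∈ s, f (x - P i)) x = c • ∑ i ∈ s, ∇ f (x - P i) := by
  have h1 : HasFDerivAt (fun x => c * ∑ i ∈ s, f (x - P i))
      (c • ∑ i ∈ s, fderiv ℝ f (x - P i)) x := by
    refine (HasFDerivAt.fun_sum fun i _ => ?_).const_mul c
    have := (hf (x - P i)).hasFDerivAt.comp x ((hasFDerivAt_id x).sub_const (P i))
    simpa [Function.comp_def] using this
  rw [gradient, h1.fderiv, map_smul, map_sum]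
  rfl

/-- Spikes of depth `h`, of small support and of small energy, placed at the points of a grid. -/
lemma exists_gridSpikes (hn : 2 ≤ n) {M : ℕ} (hM : 0 < M) {ε h δ : ℝ} (hε : 0 < ε)
    (hεM : 2 * ε ≤ 1 / M) (h0 : 0 ≤ h) (h1 : h ≤ 1) (hδ : 0 < δ) :
    ∃ w : EuclideanSpace ℝ (Fin n) → ℝ, ContDiff ℝ 1 w ∧ (∀ x, w x ≤ 0) ∧ (∀ x, -h ≤ w x) ∧
      (∀ z ∈ gridIndex n M, w (gridPoint M z) ≤ -h) ∧
      (∀ x, (∀ z ∈ gridIndex n M, ε ≤ ‖x - gridPoint M z‖) → w x = 0) ∧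
      (∀ x, (n : ℝ) + 1 ≤ ‖x‖ → w x = 0 ∧ ∇ w x = 0) ∧
      eLpNorm (∇ w) n volume ≤ ENNReal.ofReal δ := by
  -- The energy budget `δ` is shared among the spikes; the added one keeps `N` visibly positive.
  set N : ℝ := (gridIndex n M).card + 1
  have hN : 0 < N := by positivity
  obtain ⟨f, hf, hf0, hf1, hf00, hfs, hfn⟩ := exists_spike hn hε (div_pos hδ hN)
  have hM1 : 1 / (M : ℝ) ≤ 1 := by
    rw [div_le_one (by exact_mod_cast hM)]
    exact_mod_cast hM
  have hgrad := gradient_const_mul_sum_translate (gridIndex n M) (gridPoint M) (-h)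
    (hf.differentiable one_ne_zero)
  have hsum0 : ∀ x, 0 ≤ ∑ z ∈ gridIndex n M, f (x - gridPoint M z) := fun x =>
    Finset.sum_nonneg fun z _ => hf0 _
  -- Grid points are at least `1 / M ≥ 2 * ε` apart, so at most one translate is nonzero at any
  -- point.
  have hsum1 : ∀ x, ∑ z ∈ gridIndex n M, f (x - gridPoint M z) ≤ 1 := by
    intro x
    by_cases hx : ∃ z ∈ gridIndex n M, ‖x - gridPoint M z‖ < ε
    · obtain ⟨z, hz, hxz⟩ := hx
      rw [Finset.sum_eq_single_of_mem z hz]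
      · exact hf1 _
      · intro z' _ hne
        refine (hfs _ ?_).1
        have h2 := le_norm_gridPoint_sub (M := M) hne
        have h3 : ‖gridPoint M z' - gridPoint M z‖
            ≤ ‖x - gridPoint M z‖ + ‖x - gridPoint M z'‖ := by
          rw [← sub_sub_sub_cancel_left _ _ x]
          exact norm_sub_le _ _
        linarith
    · push Not at hx
      rw [Finset.sum_eq_zero fun z hz => (hfs _ (hx z hz)).1]
      exact zero_le_one
  refine ⟨fun x => -h * ∑ z ∈ gridIndex n M, f (x - gridPoint M z), ?_, ?_, ?_, ?_, ?_, ?_, ?_⟩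
  · refine contDiff_const.mul (ContDiff.sum fun z _ => ?_)
    exact hf.comp (contDiff_id.sub contDiff_const)
  · intro x
    have := mul_nonneg h0 (hsum0 x)
    linarith
  · intro x
    have := mul_le_mul_of_nonneg_left (hsum1 x) h0
    linarith
  · intro z hz
    have h2 : 1 ≤ ∑ z' ∈ gridIndex n M, f (gridPoint M z - gridPoint M z') := by
      have := Finset.single_le_sum (f := fun z' => f (gridPoint M z - gridPoint M z'))
        (fun z' _ => hf0 _) hz
      simpa [hf00] using this
    have := mul_le_mul_of_nonneg_left h2 h0
    linarith
  · intro x hx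
    simp only
    rw [Finset.sum_eq_zero fun z hz => (hfs _ (hx z hz)).1, mul_zero]
  · intro x hx
    have hfar : ∀ z ∈ gridIndex n M, ε ≤ ‖x - gridPoint M z‖ := fun z hz => by
      have h2 := norm_gridPoint_le hM hz
      have h3 := norm_sub_norm_le x (gridPoint M z)
      linarith
    rw [hgrad]
    beta_reduce
    rw [Finset.sum_eq_zero fun z hz => (hfs _ (hfar z hz)).1,
      Finset.sum_eq_zero fun z hz => (hfs _ (hfar z hz)).2]
    simp
  · have hgc := continuous_gradient hf
    have e : ∇ (fun x => -h * ∑ z ∈ gridIndex n M, f (x - gridPoint M z))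
        = (-h) • ∑ z ∈ gridIndex n M, fun x => ∇ f (x - gridPoint M z) := by
      ext1 x
      rw [hgrad, Pi.smul_apply, Finset.sum_apply]
    have htr : ∀ z, eLpNorm (fun x => ∇ f (x - gridPoint M z)) n volume = eLpNorm (∇ f) n volume :=
      fun z => eLpNorm_comp_measurePreserving hgc.aestronglyMeasurable
        (measurePreserving_sub_right volume (gridPoint M z))
    have hh : ‖-h‖ₑ ≤ 1 := by
      rw [enorm_neg, Real.enorm_of_nonneg h0]
      exact ENNReal.ofReal_le_one.2 h1
    have hn1 : (1 : ℝ≥0∞) ≤ n := by exact_mod_cast (by omega : 1 ≤ n)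
    rw [e]
    calc _ ≤ ‖-h‖ₑ * eLpNorm (∑ z ∈ gridIndex n M, fun x => ∇ f (x - gridPoint M z)) n volume :=
          eLpNorm_const_smul_le
      _ ≤ 1 * ∑ z ∈ gridIndex n M, eLpNorm (fun x => ∇ f (x - gridPoint M z)) n volume := by
          gcongr
          exact eLpNorm_sum_le (fun z _ =>
            (hgc.comp (continuous_id.sub continuous_const)).aestronglyMeasurable) hn1
      _ ≤ 1 * ∑ _z ∈ gridIndex n M, ENNReal.ofReal (δ / N) := by
          gcongr with z
          rw [htr]
          exact hfn
      _ = ENNReal.ofReal ((gridIndex n M).card * (δ / N)) := by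
          rw [one_mul, Finset.sum_const, nsmul_eq_mul, ENNReal.ofReal_mul (by positivity),
            ENNReal.ofReal_natCast]
      _ ≤ ENNReal.ofReal δ := by
          refine ENNReal.ofReal_le_ofReal ?_
          rw [mul_div_assoc', div_le_iff₀ hN]
          simp only [N]
          nlinarith

end Grid

/-! ### Choice of scales and distant minimizers -/

section Construction

variable {n : ℕ}

/-- Reciprocal of the mesh of the `k`-th grid. -/
def mesh (n k : ℕ) : ℕ := 2048 * n * 16 ^ k

/-- Radius of the supports of the `k`-th spikes. -/
noncomputable def spikeRadius (n k : ℕ) : ℝ := 1 / (32768 * n) * (1 / 32) ^ k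

/-- Times in `[timeScale n (k + 1), timeScale n k]` see the `k`-th spikes. -/
noncomputable def timeScale (n k : ℕ) : ℝ := 1 / (32768 * n) * (1 / 64) ^ k

/-- The points of the unit ball away from all the spikes. -/
def goodSet (n : ℕ) : Set (EuclideanSpace ℝ (Fin n)) :=
  Metric.ball 0 1 \ ⋃ k, ⋃ z ∈ gridIndex n (mesh n k),
    Metric.ball (gridPoint (mesh n k) z) (2 * spikeRadius n k)

lemma mesh_pos (hn : 0 < n) (k : ℕ) : 0 < mesh n k := by unfold mesh; positivity

lemma spikeRadius_pos (hn : 0 < n) (k : ℕ) : 0 < spikeRadius n k := by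
  unfold spikeRadius; positivity

lemma spikeRadius_anti {j k : ℕ} (hjk : j ≤ k) : spikeRadius n k ≤ spikeRadius n j := by
  unfold spikeRadius
  exact mul_le_mul_of_nonneg_left
    (pow_le_pow_of_le_one (by norm_num) (by norm_num) hjk) (by positivity)

/-- Moving at speed `2 ^ k` up to this time goes no further than one spike radius. -/
lemma two_pow_mul_timeScale (n k : ℕ) : 2 ^ k * timeScale n k = spikeRadius n k := by
  unfold timeScale spikeRadius
  rw [mul_left_comm, ← mul_pow]
  norm_num

lemma four_mul_mesh_mul_spikeRadius (hn : 0 < n) (k : ℕ) :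
    4 * (mesh n k * spikeRadius n k) = 1 / 4 * (1 / 2) ^ k := by
  have hn' : (n : ℝ) ≠ 0 := by positivity
  have : ((1 : ℝ) / 2) ^ k = 16 ^ k * (1 / 32) ^ k := by rw [← mul_pow]; norm_num
  rw [this]
  unfold mesh spikeRadius
  push_cast
  field_simp
  norm_num

lemma two_mul_spikeRadius_le (hn : 0 < n) (k : ℕ) : 2 * spikeRadius n k ≤ 1 / mesh n k := by
  have hm : (0 : ℝ) < mesh n k := by exact_mod_cast mesh_pos hn k
  rw [le_div_iff₀ hm]
  have h1 := four_mul_mesh_mul_spikeRadius hn k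
  have h2 : ((1 : ℝ) / 2) ^ k ≤ 1 := pow_le_one₀ (by norm_num) (by norm_num)
  linarith

/-- The cost of reaching a nearby grid point at the earliest, hence dearest, time of the `k`-th
range is a quarter of the spike depth. -/
lemma mesh_cost (hn : 0 < n) (k : ℕ) :
    n / (mesh n k : ℝ) ^ 2 / (2 * timeScale n (k + 1)) = 1 / 4 * (1 / 4) ^ k := by
  have hn' : (n : ℝ) ≠ 0 := by positivity
  unfold mesh timeScale
  push_cast
  simp only [one_div, inv_pow, mul_pow]
  have h2 : ((16 : ℝ) ^ k) ^ 2 = 64 ^ k * 4 ^ k := by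
    rw [← pow_mul, mul_comm, pow_mul, ← mul_pow]
    norm_num
  field_simp
  rw [h2, pow_succ]
  ring

lemma measurableSet_goodSet : MeasurableSet (goodSet n) :=
  Metric.isOpen_ball.measurableSet.diff <| MeasurableSet.iUnion fun _ =>
    Finset.measurableSet_biUnion _ fun _ _ => Metric.isOpen_ball.measurableSet

/-- Union bound: the `(2 * mesh n k) ^ n` balls of index `k` take up at most the fraction `(1 / 4) *
(1 / 2) ^ k` of the unit ball, and these fractions sum to one half. -/
lemma volume_goodSet_pos (hn : 0 < n) : 0 < volume (goodSet n) := by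
  have : Nonempty (Fin n) := Fin.pos_iff_nonempty.1 hn
  set V := volume (Metric.ball (0 : EuclideanSpace ℝ (Fin n)) 1) with hV
  have hV0 : V ≠ 0 := (Metric.measure_ball_pos _ _ one_pos).ne'
  have hVt : V ≠ ⊤ := measure_ball_lt_top.ne
  have hk : ∀ k, volume (⋃ z ∈ gridIndex n (mesh n k),
      Metric.ball (gridPoint (mesh n k) z) (2 * spikeRadius n k))
      ≤ ENNReal.ofReal (1 / 4 * (1 / 2) ^ k) * V := by
    intro k
    have hr := (spikeRadius_pos hn k).le
    refine (measure_biUnion_finset_le _ _).trans ?_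
    simp only [Measure.addHaar_ball volume _ (mul_nonneg zero_le_two hr), finrank_euclideanSpace,
      Fintype.card_fin, Finset.sum_const, card_gridIndex, nsmul_eq_mul]
    rw [← mul_assoc]
    gcongr
    rw [← ENNReal.ofReal_natCast, ← ENNReal.ofReal_mul (by positivity)]
    refine ENNReal.ofReal_le_ofReal ?_
    push_cast
    rw [← mul_pow]
    have e : 2 * (mesh n k : ℝ) * (2 * spikeRadius n k) = 1 / 4 * (1 / 2) ^ k := by
      rw [← four_mul_mesh_mul_spikeRadius hn k]; ring
    rw [e]
    refine pow_le_of_le_one (by positivity) ?_ hn.ne'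
    have h2 : ((1 : ℝ) / 2) ^ k ≤ 1 := pow_le_one₀ (by norm_num) (by norm_num)
    linarith
  have hbad : volume (⋃ k, ⋃ z ∈ gridIndex n (mesh n k),
      Metric.ball (gridPoint (mesh n k) z) (2 * spikeRadius n k)) < V := by
    calc _ ≤ ∑' k, ENNReal.ofReal (1 / 4 * (1 / 2) ^ k) * V :=
          (measure_iUnion_le _).trans (ENNReal.tsum_le_tsum hk)
      _ = ENNReal.ofReal (1 / 2) * V := by
          have hs := summable_geometric_two.mul_left (1 / 4 : ℝ)
          rw [ENNReal.tsum_mul_right, ← ENNReal.ofReal_tsum_of_nonneg (fun k => by positivity) hs,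
            tsum_mul_left, tsum_geometric_two]
          norm_num
      _ < 1 * V := (ENNReal.mul_lt_mul_iff_left hV0 hVt).2 (by
          rw [ENNReal.ofReal_lt_one]; norm_num)
      _ = V := one_mul V
  exact (tsub_pos_of_lt hbad).trans_le (le_measure_sdiff)

variable {w : ℕ → EuclideanSpace ℝ (Fin n) → ℝ}

lemma summable_of_spikes (h0 : ∀ k x, w k x ≤ 0) (h1 : ∀ k x, -(1 / 4) ^ k ≤ w k x)
    (x : EuclideanSpace ℝ (Fin n)) : Summable fun k => w k x := by
  refine Summable.of_norm_bounded (g := fun k => ((1 : ℝ) / 4) ^ k)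
    (summable_geometric_of_lt_one (by norm_num) (by norm_num)) fun k => ?_
  rw [Real.norm_eq_abs, abs_le]
  exact ⟨h1 k x, (h0 k x).trans (by positivity)⟩

lemma tsum_spikes_le (h0 : ∀ k x, w k x ≤ 0) (h1 : ∀ k x, -(1 / 4) ^ k ≤ w k x) (k : ℕ)
    (x : EuclideanSpace ℝ (Fin n)) : ∑' j, w j x ≤ w k x := by
  have := (summable_of_spikes h0 h1 x).neg.le_tsum k fun j _ => neg_nonneg.2 (h0 j x)
  rw [tsum_neg] at this
  linarith

lemma le_tsum_spikes (h0 : ∀ k x, w k x ≤ 0) (h1 : ∀ k x, -(1 / 4) ^ k ≤ w k x) (k : ℕ)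
    {x : EuclideanSpace ℝ (Fin n)} (hx : ∀ j < k, w j x = 0) :
    -(4 / 3 * (1 / 4) ^ k) ≤ ∑' j, w j x := by
  have hs := summable_of_spikes h0 h1 x
  rw [← hs.sum_add_tsum_nat_add k, Finset.sum_eq_zero fun j hj => hx j (Finset.mem_range.1 hj),
    zero_add]
  have hg : HasSum (fun j => -((1 : ℝ) / 4) ^ (j + k)) (-(4 / 3 * (1 / 4) ^ k)) := by
    have := ((hasSum_geometric_of_lt_one (r := (1 : ℝ) / 4) (by norm_num) (by norm_num)).mul_right
      ((1 / 4) ^ k)).neg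
    simp only [← pow_add] at this
    rwa [show (1 - (1 : ℝ) / 4)⁻¹ = 4 / 3 by norm_num] at this
  exact hasSum_le (fun j => h1 _ _) hg ((summable_nat_add_iff k).2 hs).hasSum

/-- On the good set, the minimizers in the Hopf-Lax formula at time `t ≈ timeScale n k` are at
distance more than `2 ^ k * t`. -/
lemma lt_norm_minimizer_sub (hn : 0 < n) (h0 : ∀ k x, w k x ≤ 0)
    (h1 : ∀ k x, -(1 / 4) ^ k ≤ w k x)
    (hdeep : ∀ k, ∀ z ∈ gridIndex n (mesh n k), w k (gridPoint (mesh n k) z) ≤ -(1 / 4) ^ k)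
    (hfar : ∀ k x, (∀ z ∈ gridIndex n (mesh n k), spikeRadius n k ≤ ‖x - gridPoint (mesh n k) z‖) →
      w k x = 0)
    {x y : EuclideanSpace ℝ (Fin n)} (hx : x ∈ goodSet n) {k : ℕ} {t : ℝ}
    (ht1 : timeScale n (k + 1) ≤ t) (ht2 : t ≤ timeScale n k)
    (hy : infConv quadL (fun x => ∑' k, w k x) t x = ∑' k, w k y + ‖y - x‖ ^ 2 / (2 * t)) :
    2 ^ k * t < ‖y - x‖ := by
  by_contra! hle
  have hts : 0 < timeScale n (k + 1) := by unfold timeScale; positivity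
  have ht : 0 < t := hts.trans_le ht1
  have hyk : ‖y - x‖ ≤ spikeRadius n k :=
    hle.trans ((mul_le_mul_of_nonneg_left ht2 (by positivity)).trans_eq
      (two_pow_mul_timeScale n k))
  -- As `x` is two radii from each centre and radii decrease with the index, `y` is still one radius
  -- away from the centres of index `j ≤ k`.
  have hvanish : ∀ j < k + 1, w j y = 0 := by
    intro j hj
    refine hfar j y fun z hz => ?_
    have hxz : 2 * spikeRadius n j ≤ ‖x - gridPoint (mesh n j) z‖ := by
      by_contra! hlt
      exact hx.2 (mem_iUnion.2 ⟨j, mem_iUnion₂.2 ⟨z, hz, by rwa [mem_ball_iff_norm]⟩⟩)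
    have htri : ‖x - gridPoint (mesh n j) z‖ ≤ ‖y - x‖ + ‖y - gridPoint (mesh n j) z‖ := by
      rw [← sub_sub_sub_cancel_left _ _ y]
      exact (norm_sub_le _ _).trans_eq (add_comm _ _)
    have := spikeRadius_anti (n := n) (Nat.lt_succ_iff.1 hj)
    linarith
  have hlow := le_tsum_spikes h0 h1 (k + 1) hvanish
  obtain ⟨z, hz, hzx⟩ := exists_gridPoint_near (mesh_pos hn k) (x := x) (by simpa using hx.1)
  have hb : ∀ y, -(4 / 3 : ℝ) ≤ ∑' k, w k y := fun y => by
    simpa using le_tsum_spikes h0 h1 0 (x := y) (by simp)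
  have hup := infConv_quadL_le hb ht x (gridPoint (mesh n k) z)
  have hz2 := (tsum_spikes_le h0 h1 k (gridPoint (mesh n k) z)).trans (hdeep k z hz)
  have hcost : ‖gridPoint (mesh n k) z - x‖ ^ 2 / (2 * t) ≤ 1 / 4 * (1 / 4) ^ k := by
    rw [← mesh_cost hn k]
    gcongr
  have hpos : 0 ≤ ‖y - x‖ ^ 2 / (2 * t) := by positivity
  -- In units of `4⁻ᵏ`, `hlow` gives `u_t(x) ≥ -1/3`, while `hup`, `hz2` and `hcost` give `u_t(x) ≤
  -- -1 + 1/4`.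
  have h4 : (0 : ℝ) < (1 / 4) ^ k := by positivity
  rw [pow_succ] at hlow
  linarith

lemma eventually_exists_timeScale (hn : 0 < n) (A : ℝ) :
    ∀ᶠ t in 𝓝[>] (0 : ℝ), ∃ k, A ≤ 2 ^ k ∧ timeScale n (k + 1) ≤ t ∧ t ≤ timeScale n k := by
  obtain ⟨K, hK⟩ := pow_unbounded_of_one_lt A (one_lt_two)
  have hc : (0 : ℝ) < 32768 * n := by positivity
  have hKpos : 0 < timeScale n K := by unfold timeScale; positivity
  filter_upwards [Ioo_mem_nhdsGT hKpos] with t ht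
  have e : ∀ k, timeScale n k = (1 / 64) ^ k / (32768 * n) := fun k => by
    unfold timeScale; ring
  have h1 : t * (32768 * n) < (1 / 64) ^ K := by
    have := ht.2
    rwa [e, lt_div_iff₀ hc] at this
  obtain ⟨k, hk1, hk2⟩ := exists_nat_pow_near_of_lt_one (x := t * (32768 * n)) (y := (1 : ℝ) / 64)
    (mul_pos ht.1 hc) (h1.le.trans (pow_le_one₀ (by norm_num) (by norm_num))) (by norm_num)
    (by norm_num)
  have hKk : K < k + 1 :=
    (pow_lt_pow_iff_right_of_lt_one₀ (by norm_num) (by norm_num)).1 (hk1.trans h1)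
  refine ⟨k, hK.le.trans (pow_le_pow_right₀ one_le_two (Nat.lt_succ_iff.1 hKk)), ?_, ?_⟩
  · rw [e, div_le_iff₀ hc]; exact hk1.le
  · rw [e, le_div_iff₀ hc]; exact hk2

/-- A continuous Sobolev function whose Hopf-Lax minimizers are far away on a set of positive
measure. -/
lemma exists_far_minimizers (hn : 2 ≤ n) :
    ∃ u : EuclideanSpace ℝ (Fin n) → ℝ, ∃ g : EuclideanSpace ℝ (Fin n) → EuclideanSpace ℝ (Fin n),
      ∃ R C : ℝ, Continuous u ∧ (∀ x, R ≤ ‖x‖ → u x = 0) ∧ (∀ x, -C ≤ u x) ∧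
        HasWeakGradient u g ∧ MemLp g n volume ∧ (∀ x, R ≤ ‖x‖ → g x = 0) ∧
        ∃ E : Set (EuclideanSpace ℝ (Fin n)), MeasurableSet E ∧ 0 < volume E ∧
          ∀ x ∈ E, ∀ A : ℝ, ∀ᶠ t in 𝓝[>] (0 : ℝ), ∀ y,
            infConv quadL u t x = u y + ‖y - x‖ ^ 2 / (2 * t) → A * t < ‖y - x‖ := by
  have hn0 : 0 < n := by omega
  choose w hw hw0 hw1 hdeep hfar hout hgrad using fun k : ℕ =>
    exists_gridSpikes hn (mesh_pos hn0 k) (spikeRadius_pos hn0 k) (two_mul_spikeRadius_le hn0 k)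
      (h := (1 / 4) ^ k) (δ := (1 / 2) ^ k) (by positivity)
      (pow_le_one₀ (by norm_num) (by norm_num)) (by positivity)
  have hwabs : ∀ k x, |w k x| ≤ (1 / 4) ^ k := fun k x =>
    abs_le.2 ⟨hw1 k x, (hw0 k x).trans (by positivity)⟩
  have hsum : Summable fun k : ℕ => ((1 : ℝ) / 4) ^ k :=
    summable_geometric_of_lt_one (by norm_num) (by norm_num)
  have hfin : ∑' k, eLpNorm (∇ (w k)) n volume ≠ ⊤ := by
    refine ne_top_of_le_ne_top ?_ (ENNReal.tsum_le_tsum hgrad)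
    rw [← ENNReal.ofReal_tsum_of_nonneg (fun k => by positivity) summable_geometric_two]
    exact ENNReal.ofReal_ne_top
  obtain ⟨g, hg, hgLp, hg0⟩ := hasWeakGradient_tsum (by exact_mod_cast hn0) hw hout hsum hwabs hfin
  refine ⟨fun x => ∑' k, w k x, g, n + 1, 4 / 3, continuous_tsum (fun k => (hw k).continuous) hsum
    hwabs, fun x hx => by simp [(hout _ x hx).1], fun x => ?_, hg, hgLp, hg0, goodSet n,
    measurableSet_goodSet, volume_goodSet_pos hn0, fun x hx A => ?_⟩
  · simpa using le_tsum_spikes hw0 hw1 0 (x := x) (by simp)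
  · filter_upwards [eventually_exists_timeScale hn0 A, self_mem_nhdsWithin] with t ht ht0 y hy
    obtain ⟨k, hA, ht1, ht2⟩ := ht
    exact (mul_le_mul_of_nonneg_right hA (le_of_lt ht0)).trans_lt
      (lt_norm_minimizer_sub hn0 hw0 hw1 hdeep hfar hx ht1 ht2 hy)

end Construction

/-! ### Failure of convergence in `Lᵖ` -/

section NonConvergence

variable {n : ℕ} {u : EuclideanSpace ℝ (Fin n) → ℝ} {C : ℝ}

/-- Convergence in `Lᵖ` implies convergence in measure, hence almost everywhere along some sequence
of times. Almost every point is one of differentiability for all these countably many times, so some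
point of `E` has both a finite limit and blow-up. -/
lemma not_tendsto_eLpNorm_gradient_infConv (hb : ∀ y, -C ≤ u y)
    {E : Set (EuclideanSpace ℝ (Fin n))} (hE : 0 < volume E)
    (hblow : ∀ x ∈ E, Tendsto (fun t : ℝ => ‖∇ (infConv quadL u t) x‖)
      (𝓝[>] 0 ⊓ 𝓟 {t : ℝ | DifferentiableAt ℝ (infConv quadL u t) x}) atTop)
    {p : ℝ≥0∞} (hp : p ≠ 0) {g : EuclideanSpace ℝ (Fin n) → EuclideanSpace ℝ (Fin n)}
    (hg : AEStronglyMeasurable g volume) :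
    ¬ Tendsto (fun t : ℝ => eLpNorm (fun x => ∇ (infConv quadL u t) x - g x) p volume)
      (𝓝[>] 0) (𝓝 0) := by
  intro hlim
  have hmeas : ∀ t, AEStronglyMeasurable (∇ (infConv quadL u t)) volume := fun t =>
    ((InnerProductSpace.toDual ℝ (EuclideanSpace ℝ (Fin n))).symm.continuous.measurable.comp
      (measurable_fderiv ℝ (infConv quadL u t))).aestronglyMeasurable
  obtain ⟨s, hs, hsg⟩ := (tendstoInMeasure_of_tendsto_eLpNorm hp hmeas hg
    hlim).exists_seq_tendsto_ae'
  have hdiff : ∀ᵐ x : EuclideanSpace ℝ (Fin n), ∀ i, 0 < s i →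
      DifferentiableAt ℝ (infConv quadL u (s i)) x := by
    refine ae_all_iff.2 fun i => ?_
    by_cases hi : 0 < s i
    · filter_upwards [ae_differentiableAt_infConv hb hi] with x hx _ using hx
    · exact Eventually.of_forall fun x h => absurd h hi
  obtain ⟨x, hxE, hxd, hxg⟩ : ∃ x ∈ E, (∀ i, 0 < s i → DifferentiableAt ℝ (infConv quadL u (s i)) x)
      ∧ Tendsto (fun i => ∇ (infConv quadL u (s i)) x) atTop (𝓝 (g x)) := by
    by_contra! hcon
    refine hE.ne' (measure_mono_null (fun x hx => ?_) (ae_iff.1 (hdiff.and hsg)))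
    exact fun h => hcon x hx h.1 h.2
  have hs' : Tendsto s atTop (𝓝[>] 0 ⊓ 𝓟 {t : ℝ | DifferentiableAt ℝ (infConv quadL u t) x}) := by
    refine tendsto_inf.2 ⟨hs, tendsto_principal.2 ?_⟩
    filter_upwards [hs.eventually self_mem_nhdsWithin] with i hi using hxd i hi
  exact not_tendsto_nhds_of_tendsto_atTop ((hblow x hxE).comp hs') _ hxg.norm

end NonConvergence

theorem theorem1p3 (n : ℕ) (hn : 2 ≤ n) :
    ∃ u : EuclideanSpace ℝ (Fin n) → ℝ,
      Continuous u ∧ HasCompactSupport u ∧ MemW1p u (n : ℝ≥0∞) ∧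
      -- each `u_t` is differentiable almost everywhere
      (∀ t : ℝ, 0 < t → ∀ᵐ x, DifferentiableAt ℝ (infConv quadL u t) x) ∧
      -- `|Du_t| → ∞` on a set of positive measure
      (∃ E : Set (EuclideanSpace ℝ (Fin n)), MeasurableSet E ∧ 0 < volume E ∧
        ∀ x ∈ E,
          (∀ᵐ t ∂(volume.restrict (Ioi (0 : ℝ))), DifferentiableAt ℝ (infConv quadL u t) x) ∧
          -- along all `t` at which the gradient `Du_t(x)` exists
          Tendsto (fun t : ℝ => ‖∇ (infConv quadL u t) x‖)
            (𝓝[>] 0 ⊓ 𝓟 {t : ℝ | DifferentiableAt ℝ (infConv quadL u t) x}) atTop ∧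
          -- along all `t`, for the largest one-sided directional derivative
          (∀ M : ℝ, ∀ᶠ t in 𝓝[>] (0 : ℝ), ∃ γ : EuclideanSpace ℝ (Fin n), ‖γ‖ = 1 ∧
            ∃ d : ℝ, HasDirDeriv (infConv quadL u t) d x γ ∧ M ≤ |d|)) ∧
      -- hence `Du_t` does not converge to `Du` in `L^p` for any `1 ≤ p ≤ n`
      (∀ p : ℝ≥0∞, 1 ≤ p → p ≤ (n : ℝ≥0∞) → MemW1p u p ∧
        ∀ g : EuclideanSpace ℝ (Fin n) → EuclideanSpace ℝ (Fin n), HasWeakGradient u g →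
          ¬ Tendsto (fun t : ℝ => eLpNorm (fun x => ∇ (infConv quadL u t) x - g x) p volume)
            (𝓝[>] 0) (𝓝 0)) := by
  obtain ⟨u, g, R, C, hu, hu0, hb, hg, hgLp, hg0, E, hEm, hE, hfar⟩ := exists_far_minimizers hn
  have hW : ∀ p : ℝ≥0∞, p ≤ n → MemW1p u p := fun p hp => memW1p_of_le hu hg hgLp hu0 hg0 hp
  have hgradient : ∀ x ∈ E, Tendsto (fun t : ℝ => ‖∇ (infConv quadL u t) x‖)
      (𝓝[>] 0 ⊓ 𝓟 {t : ℝ | DifferentiableAt ℝ (infConv quadL u t) x}) atTop := by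
    intro x hx
    refine tendsto_atTop.2 fun A => ?_
    rw [eventually_inf_principal]
    filter_upwards [hfar x hx A, self_mem_nhdsWithin] with t ht ht0 hd
    have ht0 : 0 < t := ht0
    obtain ⟨y, hy⟩ := exists_infConv_quadL_eq hu hb ht0 x
    rw [gradient_infConv hb ht0 hy hd, norm_smul, norm_inv, Real.norm_of_nonneg ht0.le,
      norm_sub_rev, inv_mul_eq_div, le_div_iff₀ ht0]
    exact (ht y hy).le
  have hnull := ae_iff.1 (ae_ae_differentiableAt_infConv hb)
  -- The exceptional null set is enlarged to a measurable one, so that `E \ N` stays measurable.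
  set N := toMeasurable volume {x : EuclideanSpace ℝ (Fin n) |
    ¬ ∀ᵐ t ∂(volume.restrict (Ioi (0 : ℝ))), DifferentiableAt ℝ (infConv quadL u t) x}
  have hN : volume N = 0 := (measure_toMeasurable _).trans hnull
  refine ⟨u, hu, ?_, hW n le_rfl, fun t ht => ae_differentiableAt_infConv hb ht,
    ⟨E \ N, hEm.diff (measurableSet_toMeasurable _ _), ?_, fun x hx => ⟨?_, hgradient x hx.1, ?_⟩⟩,
    fun p hp1 hpn => ⟨hW p hpn, fun g' hg' => ?_⟩⟩
  · exact HasCompactSupport.intro (isCompact_closedBall 0 R) fun x hx =>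
      hu0 x (by simpa using (not_le.1 (by simpa using hx)).le)
  · rwa [measure_sdiff_null hN]
  · by_contra hcon
    exact hx.2 (subset_toMeasurable _ _ hcon)
  · intro M
    -- The maximum with zero ensures `y ≠ x`, so that the direction towards the minimizer is
    -- defined.
    filter_upwards [hfar x hx.1 (max M 0), self_mem_nhdsWithin] with t ht ht0
    have ht0 : 0 < t := ht0
    obtain ⟨y, hy⟩ := exists_infConv_quadL_eq hu hb ht0 x
    have hlt := ht y hy
    have hne : y ≠ x := sub_ne_zero.1 (norm_pos_iff.1
      ((mul_nonneg (le_max_right M 0) ht0.le).trans_lt hlt))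
    obtain ⟨γ, hγ, d, hd, hd2⟩ := exists_hasDirDeriv_infConv hb ht0 hne hy
    refine ⟨γ, hγ, d, hd, ((le_max_left M 0).trans ?_).trans hd2⟩
    exact (le_div_iff₀ ht0).2 hlt.le
  · exact not_tendsto_eLpNorm_gradient_infConv hb hE hgradient (zero_lt_one.trans_le hp1).ne'
      hg'.2.1.aestronglyMeasurable
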